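/- Let $\mathscr{L}$ be a real Hilbert space and $(\Omega,\mathcal{F},\mathbb{P})$ a probability space. Let $\Phi:\mathscr{L}\to L^{2}(\Omega,\mathbb{P})$ be a Gaussian field, i.e. a real linear map such that $(\Phi(h))_{h\in\mathscr{L}}$ is a centered Gaussian process with $\mathbb{E}(\Phi(h)\Phi(k))=\langle h,k\rangle_{\mathscr{L}}$ for all $h,k\in\mathscr{L}$, and assume that $\mathcal{F}$ is, up to $\mathbb{P}$-null sets, the $\sigma$-algebra generated by $\{\Phi(h):h\in\mathscr{L}\}$. Put $\mathscr{H}_{1}=L^{2}(\Omega,\mathbb{P})$ (real-valued) and $\mathscr{H}_{2}=L^{2}(\Omega,\mathbb{P})\otimes\mathscr{L}=L^{2}(\Omega\to\mathscr{L},\mathbb{P})$, where $F\otimes k$ is the function $\omega\mapsto F(\omega)k$. Let $\mathscr{D}\subset\mathscr{H}_{1}$ be the span of all $p(\Phi(h_{1}),\dots,\Phi(h_{n}))$ with $n\in\mathbb{N}$, $h_{1},\dots,h_{n}\in\mathscr{L}$ and $p\in\mathbb{R}[x_{1},\dots,x_{n}]$. The Malliavin derivative $T:\mathscr{H}_{1}\to\mathscr{H}_{2}$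 with domain $\mathscr{D}$, and its companion operator $S:\mathscr{H}_{2}\to\mathscr{H}_{1}$ with domain the algebraic tensor product $\mathscr{D}\otimes\mathscr{L}$, given by $$T\big(p(\Phi(h_{1}),\dots,\Phi(h_{n}))\big)=\sum_{j=1}^{n}\frac{\partial p}{\partial x_{j}}(\Phi(h_{1}),\dots,\Phi(h_{n}))\otimes h_{j},\qquad S(F\otimes k)=\Phi(k)F-\langle T(F),k\rangle_{\mathscr{L}},$$ are well-defined linear operators. The operator $T$ is closable and its closure is the adjoint of $S$: $$\overline{T}=S^{*}.$$ Moreover, $(S,T)$ is a maximal symmetric pair: $\operatorname{dom}(T)$ is dense in $\mathscr{H}_{1}$, $\operatorname{dom}(S)$ is dense in $\mathscr{H}_{2}$, $\langle Tu,v\rangle_{\mathscr{H}_{2}}=\langle u,Sv\rangle_{\mathscr{H}_{1}}$ for all $u\in\operatorname{dom}(T)$ and $v\in\operatorname{dom}(S)$, both operators are closable, $\overline{T}=S^{*}$ and $\overline{S}=T^{*}$. -/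

import Mathlib

open MeasureTheory ProbabilityTheory
open scoped RealInnerProductSpace

noncomputable section

namespace MalliavinCalculus

variable {Ω : Type*} [MeasurableSpace Ω] {P : Measure Ω}
variable {L : Type*} [NormedAddCommGroup L] [InnerProductSpace ℝ L]

/-- A Gaussian field over the real Hilbert space `L`: a linear map `Φ : L → L²(Ω, P)` such that
`(Φ h)` is a centered Gaussian process indexed by `L`, with covariance `E (Φ h Φ k) = ⟪h, k⟫`. -/
structure IsGaussianField (Φ : L →ₗ[ℝ] Lp ℝ 2 P) : Prop where
  isGaussianProcess : IsGaussianProcess (fun (h : L) (ω : Ω) => Φ h ω) P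
  mean : ∀ h : L, ∫ ω, Φ h ω ∂P = 0
  covariance : ∀ h k : L, ∫ ω, Φ h ω * Φ k ω ∂P = ⟪h, k⟫

/-- Up to null sets, the ambient σ-algebra is generated by the random variables `Φ h`. -/
def GeneratesSigmaAlgebra (Φ : L →ₗ[ℝ] Lp ℝ 2 P) : Prop :=
  ∀ A : Set Ω, MeasurableSet A → ∃ B : Set Ω,
    MeasurableSet[⨆ h : L, MeasurableSpace.comap (fun ω => Φ h ω) (borel ℝ)] B ∧ A =ᵐ[P] B

/-- The random variable `p (Φ h₁, …, Φ hₙ)`, as a function on `Ω`. -/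
def polyFun (Φ : L →ₗ[ℝ] Lp ℝ 2 P) {n : ℕ} (h : Fin n → L) (p : MvPolynomial (Fin n) ℝ)
    (ω : Ω) : ℝ :=
  MvPolynomial.eval (fun i => Φ (h i) ω) p

/-- The random vector `∑ j, (∂p/∂xⱼ) (Φ h₁, …, Φ hₙ) ⊗ hⱼ`, as a function `Ω → L`. -/
def gradFun (Φ : L →ₗ[ℝ] Lp ℝ 2 P) {n : ℕ} (h : Fin n → L) (p : MvPolynomial (Fin n) ℝ)
    (ω : Ω) : L :=
  ∑ j, polyFun Φ h (MvPolynomial.pderiv j p) ω • h j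

/-- The space `𝒟 ⊆ L²(Ω, P)` of polynomial fields: the span of all `p (Φ h₁, …, Φ hₙ)`. -/
def polyFields (Φ : L →ₗ[ℝ] Lp ℝ 2 P) : Submodule ℝ (Lp ℝ 2 P) :=
  Submodule.span ℝ {F | ∃ (n : ℕ) (h : Fin n → L) (p : MvPolynomial (Fin n) ℝ),
    F =ᵐ[P] polyFun Φ h p}

/-- The Malliavin derivative `T : L²(Ω, P) → L²(Ω, P; L)` with domain `𝒟`, given by
`p (Φ h₁, …, Φ hₙ) ↦ ∑ j, (∂p/∂xⱼ) (Φ h₁, …, Φ hₙ) ⊗ hⱼ`. It is introduced through its graph;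
that this graph is single-valued is not part of the definition. -/
def malliavinDerivative (Φ : L →ₗ[ℝ] Lp ℝ 2 P) : Lp ℝ 2 P →ₗ.[ℝ] Lp L 2 P :=
  (Submodule.span ℝ {x : Lp ℝ 2 P × Lp L 2 P |
    ∃ (n : ℕ) (h : Fin n → L) (p : MvPolynomial (Fin n) ℝ),
      x.1 =ᵐ[P] polyFun Φ h p ∧ x.2 =ᵐ[P] gradFun Φ h p}).toLinearPMap

/-- The elementary tensor `F ⊗ k`, i.e. `ω ↦ F ω • k`, in `L²(Ω, P; L) = L²(Ω, P) ⊗ L`. -/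
def tensor (F : Lp ℝ 2 P) (k : L) : Lp L 2 P :=
  (ContinuousLinearMap.toSpanSingleton ℝ k).compLp F

/-- The algebraic tensor product `𝒟 ⊗ L`, as a subspace of `L²(Ω, P; L)`. -/
def tensorFields (Φ : L →ₗ[ℝ] Lp ℝ 2 P) : Submodule ℝ (Lp L 2 P) :=
  Submodule.span ℝ {ψ | ∃ F ∈ polyFields Φ, ∃ k : L, ψ = tensor F k}

/-- The random variable `Φ k * F - ⟪T F, k⟫`, as a function on `Ω`. -/
def companionFun (Φ : L →ₗ[ℝ] Lp ℝ 2 P) (F : (malliavinDerivative Φ).domain) (k : L)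
    (ω : Ω) : ℝ :=
  Φ k ω * (F : Lp ℝ 2 P) ω - ⟪malliavinDerivative Φ F ω, k⟫

/-- The companion operator `S : L²(Ω, P; L) → L²(Ω, P)` with domain `𝒟 ⊗ L`, given by
`S (F ⊗ k) = Φ k * F - ⟪T F, k⟫`. It is introduced through its graph; that this graph is
single-valued is not part of the definition. -/
def companion (Φ : L →ₗ[ℝ] Lp ℝ 2 P) : Lp L 2 P →ₗ.[ℝ] Lp ℝ 2 P :=
  (Submodule.span ℝ {x : Lp L 2 P × Lp ℝ 2 P |
    ∃ (F : (malliavinDerivative Φ).domain) (k : L),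
      x.1 = tensor (F : Lp ℝ 2 P) k ∧ x.2 =ᵐ[P] companionFun Φ F k}).toLinearPMap

section SymmetricPair

variable {H₁ H₂ : Type*} [NormedAddCommGroup H₁] [InnerProductSpace ℝ H₁]
  [NormedAddCommGroup H₂] [InnerProductSpace ℝ H₂]

/-- `(S, T)` is a symmetric pair: both operators are densely defined and
`⟪T u, v⟫ = ⟪u, S v⟫` for all `u ∈ dom T`, `v ∈ dom S`. -/
structure IsSymmetricPair (S : H₂ →ₗ.[ℝ] H₁) (T : H₁ →ₗ.[ℝ] H₂) : Prop where
  dense_left : Dense (S.domain : Set H₂)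
  dense_right : Dense (T.domain : Set H₁)
  formalAdjoint : T.IsFormalAdjoint S

/-- A symmetric pair `(S, T)` is maximal if `T` and `S` are closable, the closure of `T` is `S*`,
and the closure of `S` is `T*`. -/
structure IsMaximalSymmetricPair [CompleteSpace H₁] [CompleteSpace H₂]
    (S : H₂ →ₗ.[ℝ] H₁) (T : H₁ →ₗ.[ℝ] H₂) : Prop extends IsSymmetricPair S T where
  closable_left : S.IsClosable
  closable_right : T.IsClosable
  closure_right : T.closure = S.adjoint
  closure_left : S.closure = T.adjoint

end SymmetricPair

end MalliavinCalculus

end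

/-! The engine is Gaussian integration by parts, `IsGaussianField.integral_mul_polyFun`. By
polarization it suffices to treat a power of a single Φ(h). There one splits k into a multiple of h
and a vector orthogonal to h: the orthogonal part gives an independent centered variable and
contributes nothing, while the multiple of h is handled by the recursion for Gaussian moments.
Applied to a product of two polynomials, the Leibniz rule turns this identity into the formal
adjointness of S and T (`inner_tensor_eq`).

The second ingredient is that the powers Φ(h)ⁿ are total in L²
(`eq_zero_of_forall_integral_mul_pow_eq_zero`). If f is orthogonal to all of them, expanding the
exponential gives E(f exp(iΦ(h))) = 0. So the positive and negative parts of f, taken as densities,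
give the field the same law, and f = 0 because the field generates the σ-algebra. Formal adjointness
and totality together make both graphs single-valued and both domains dense.

For maximality, T is contained in the closed operator S*, so it is enough that no nonzero (u, v) in
the graph of S* is orthogonal to the graph of T. With a(n) = E(u Φ(h)ⁿ), these conditions give (n +
1) a(n) = n (n - 1) ‖h‖² a(n - 2). Hence every a(n) vanishes, so u = 0, and then v = 0
(`eq_zero_of_orthogonal`). The identity for the closure of S follows formally from the one for T. -/

namespace MalliavinCalculus

/-! ### Hilbert space criterion for maximality of a symmetric pair -/

section Abstract

variable {E F : Type*} [NormedAddCommGroup E] [InnerProductSpace ℝ E]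
  [NormedAddCommGroup F] [InnerProductSpace ℝ F]

/-- A subspace `g` of a closed subspace `K` of `E × F` is dense in `K` if no nonzero element of `K`
is orthogonal to `g`. -/
lemma topologicalClosure_eq_of_orthogonal [CompleteSpace E] [CompleteSpace F]
    {g K : Submodule ℝ (E × F)}
    (hK : IsClosed (K : Set (E × F))) (hle : g ≤ K)
    (h : ∀ x ∈ K, (∀ y ∈ g, ⟪y.1, x.1⟫ + ⟪y.2, x.2⟫ = 0) → x = 0) :
    g.topologicalClosure = K := by
  apply le_antisymm (g.topologicalClosure_minimal hle hK)
  intro x hx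
  -- The product carries the sup norm, so the orthogonal projection is taken in its ℓ² version,
  -- which has the same topology.
  let e := WithLp.prodContinuousLinearEquiv 2 ℝ E F
  let G : Submodule ℝ (WithLp 2 (E × F)) :=
    g.topologicalClosure.comap (e : WithLp 2 (E × F) →ₗ[ℝ] E × F)
  have hGc : IsClosed (G : Set (WithLp 2 (E × F))) :=
    (g.isClosed_topologicalClosure).preimage e.continuous
  have : CompleteSpace G := hGc.completeSpace_coe
  obtain ⟨a, ha, b, hb, hab⟩ := G.exists_add_mem_mem_orthogonal (e.symm x)
  have hea : e a ∈ g.topologicalClosure := ha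
  have hx' : x = e a + e b := by
    rw [← map_add, ← hab, ContinuousLinearEquiv.apply_symm_apply]
  have hb0 : e b = 0 := by
    apply h
    · have : e b = x - e a := by rw [hx']; abel
      rw [this]
      exact K.sub_mem hx (g.topologicalClosure_minimal hle hK hea)
    · intro y hy
      have hyG : e.symm y ∈ G := by
        change e (e.symm y) ∈ g.topologicalClosure
        rw [ContinuousLinearEquiv.apply_symm_apply]
        exact g.le_topologicalClosure hy
      have := (Submodule.mem_orthogonal _ _).1 hb _ hyG
      rwa [WithLp.prod_inner_apply] at this
  rw [hx', hb0, add_zero]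
  exact hea

/-- If a closed operator `A` extends `T` and no nonzero element of its graph is orthogonal to the
graph of `T`, then `A` is the closure of `T`. -/
lemma isClosable_and_closure_eq [CompleteSpace E] [CompleteSpace F]
    {T A : E →ₗ.[ℝ] F} (hA : A.IsClosed) (hTA : T ≤ A)
    (h : ∀ x ∈ A.graph, (∀ y ∈ T.graph, ⟪y.1, x.1⟫ + ⟪y.2, x.2⟫ = 0) → x = 0) :
    T.IsClosable ∧ T.closure = A := by
  have hcl := topologicalClosure_eq_of_orthogonal hA (LinearPMap.le_graph_of_le hTA) h
  have hT : T.IsClosable := ⟨A, hcl⟩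
  exact ⟨hT, LinearPMap.eq_of_eq_graph (by rw [← hT.graph_closure_eq_closure_graph, hcl])⟩

/-- A symmetric pair `(S, T)` is maximal as soon as the graph of `S*` contains no nonzero vector
orthogonal to the graph of `T`. -/
lemma IsSymmetricPair.isMaximalSymmetricPair [CompleteSpace E] [CompleteSpace F]
    {S : F →ₗ.[ℝ] E} {T : E →ₗ.[ℝ] F} (hST : IsSymmetricPair S T)
    (h : ∀ (u : E) (v : F), (∀ y ∈ S.graph, ⟪v, y.1⟫ = ⟪u, y.2⟫) →
      (∀ x ∈ T.graph, ⟪x.1, u⟫ + ⟪x.2, v⟫ = 0) → u = 0 ∧ v = 0) :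
    IsMaximalSymmetricPair S T := by
  have hS := hST.dense_left
  have hT := hST.dense_right
  have hSc : S.adjoint.IsClosed := LinearPMap.adjoint_isClosed hS
  have hTc : T.adjoint.IsClosed := LinearPMap.adjoint_isClosed hT
  have h1 : T.IsClosable ∧ T.closure = S.adjoint := by
    apply isClosable_and_closure_eq hSc
      (LinearPMap.IsFormalAdjoint.le_adjoint hS hST.formalAdjoint.symm)
    rintro ⟨u, v⟩ hx hy
    rw [LinearPMap.adjoint_graph_eq_graph_adjoint hS, Submodule.mem_adjoint_iff] at hx
    obtain ⟨rfl, rfl⟩ := h u v (fun y hy => by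
      have := hx y.1 y.2 hy
      simp only at this
      rw [real_inner_comm y.1 v, real_inner_comm y.2 u]
      linarith) hy
    rfl
  refine ⟨hST, ?_, h1.1, h1.2, ?_⟩
  all_goals
    have h2 : S.IsClosable ∧ S.closure = T.adjoint := by
      apply isClosable_and_closure_eq hTc
        (LinearPMap.IsFormalAdjoint.le_adjoint hT hST.formalAdjoint)
      rintro ⟨v, u⟩ hx hy
      -- Orthogonality of (v, u) to the graph of S says that (u, -v) lies in the graph of S*,
      -- already known to be the closure of the graph of T. The relation defining T* extends to that
      -- closure, and at (u, -v) it reads -‖v‖² - ‖u‖² = 0.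
      have hmem : (u, -v) ∈ S.adjoint.graph := by
        rw [LinearPMap.adjoint_graph_eq_graph_adjoint hS, Submodule.mem_adjoint_iff]
        intro a b hab
        have := hy _ hab
        simp only [inner_neg_right] at this ⊢
        linarith
      rw [← h1.2, ← h1.1.graph_closure_eq_closure_graph] at hmem
      rw [LinearPMap.adjoint_graph_eq_graph_adjoint hT, Submodule.mem_adjoint_iff] at hx
      have hcl : IsClosed {z : E × F | ⟪z.2, v⟫ - ⟪z.1, u⟫ = 0} :=
        isClosed_eq (by fun_prop) continuous_const
      have key : (u, -v) ∈ {z : E × F | ⟪z.2, v⟫ - ⟪z.1, u⟫ = 0} :=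
        closure_minimal (fun z hz => hx z.1 z.2 hz) hcl hmem
      have hs : ⟪v, v⟫ + ⟪u, u⟫ = 0 := by
        have : ⟪-v, v⟫ - ⟪u, u⟫ = 0 := key
        rw [inner_neg_left] at this
        linarith
      have h3 := real_inner_self_nonneg (x := v)
      have h4 := real_inner_self_nonneg (x := u)
      have hv : v = 0 := inner_self_eq_zero (𝕜 := ℝ).1 (by linarith)
      have hu : u = 0 := inner_self_eq_zero (𝕜 := ℝ).1 (by linarith)
      rw [hu, hv]; rfl
  · exact h2.1
  · exact h2.2

end Abstract

/-! ### Polarization of polynomials -/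

section Polarization

/-- If a polynomial with coefficients in a real vector space takes all its values in a subspace,
then its coefficients belong to that subspace. -/
lemma coeff_mem_of_forall_sum_pow_smul_mem {M : Type*} [AddCommGroup M] [Module ℝ M]
    (V : Submodule ℝ M) (N : ℕ) (c : ℕ → M)
    (h : ∀ t : ℝ, ∑ j ∈ Finset.range N, t ^ j • c j ∈ V) {j : ℕ} (hj : j < N) : c j ∈ V := by
  by_contra hc
  obtain ⟨f, hf, hV⟩ := Submodule.exists_le_ker_of_notMem hc
  let q : Polynomial ℝ := ∑ i ∈ Finset.range N, Polynomial.monomial i (f (c i))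
  have hq : q = 0 := by
    apply Polynomial.funext
    intro t
    have := hV (h t)
    simp only [LinearMap.mem_ker, map_sum, map_smul, smul_eq_mul] at this
    simp only [q, Polynomial.eval_finsetSum, Polynomial.eval_monomial, Polynomial.eval_zero]
    rw [← this]
    exact Finset.sum_congr rfl fun i _ => mul_comm _ _
  apply hf
  have hco : q.coeff j = f (c j) := by
    simp [q, Polynomial.coeff_monomial, hj]
  rw [← hco, hq, Polynomial.coeff_zero]

/-- Polarization: real polynomials are linear combinations of powers of linear forms. -/
lemma span_pow_linearForm_eq_top (σ : Type*) [Fintype σ] :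
    Submodule.span ℝ {p : MvPolynomial σ ℝ | ∃ (c : σ → ℝ) (m : ℕ),
      p = (∑ i, MvPolynomial.C (c i) * MvPolynomial.X i) ^ m} = ⊤ := by
  classical
  set V := Submodule.span ℝ {p : MvPolynomial σ ℝ | ∃ (c : σ → ℝ) (m : ℕ),
      p = (∑ i, MvPolynomial.C (c i) * MvPolynomial.X i) ^ m} with hV
  have hmul : ∀ (p : MvPolynomial σ ℝ) (i : σ), p ∈ V → p * MvPolynomial.X i ∈ V := by
    intro p i hp
    induction hp using Submodule.span_induction with
    | zero => simp
    | add x y _ _ hx hy => rw [add_mul]; exact V.add_mem hx hy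
    | smul a x _ hx => rw [smul_mul_assoc]; exact V.smul_mem a hx
    | mem x hx =>
      obtain ⟨c, m, rfl⟩ := hx
      set ℓ : MvPolynomial σ ℝ := ∑ i, MvPolynomial.C (c i) * MvPolynomial.X i
      -- For every t, (t Xᵢ + ℓ)^(m+1) is again a power of a linear form. Its coefficient of t is (m
      -- + 1) Xᵢ ℓᵐ, which therefore lies in V.
      have key := coeff_mem_of_forall_sum_pow_smul_mem V (m + 1 + 1)
        (fun j => MvPolynomial.X i ^ j * ℓ ^ (m + 1 - j) * ((m + 1).choose j : MvPolynomial σ ℝ))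
        (fun t => by
          have : ∑ j ∈ Finset.range (m + 1 + 1), t ^ j •
              (MvPolynomial.X i ^ j * ℓ ^ (m + 1 - j) *
                ((m + 1).choose j : MvPolynomial σ ℝ)) =
              (∑ i', MvPolynomial.C (((Pi.single i t : σ → ℝ) + c) i') * MvPolynomial.X i') ^ (m + 1) := by
            have : (∑ i', MvPolynomial.C (((Pi.single i t : σ → ℝ) + c) i') * MvPolynomial.X i') =
                MvPolynomial.C t * MvPolynomial.X i + ℓ := by
              simp only [Pi.add_apply, map_add, add_mul, Finset.sum_add_distrib, ℓ]
              congr 1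
              rw [Finset.sum_eq_single i]
              · simp
              · intro b _ hb; simp [hb]
              · simp
            rw [this, add_pow]
            refine Finset.sum_congr rfl fun j _ => ?_
            rw [mul_pow, ← map_pow, MvPolynomial.smul_eq_C_mul]
            ring
          rw [this]
          exact Submodule.subset_span ⟨_, _, rfl⟩)
        (j := 1) (by omega)
      have h2 := V.smul_mem ((m + 1 : ℝ)⁻¹) key
      convert h2 using 1
      have hm : ((m : ℝ) + 1) ≠ 0 := by positivity
      rw [MvPolynomial.smul_eq_C_mul, Nat.choose_one_right, pow_one, Nat.add_sub_cancel]
      have : (((m + 1 : ℕ) : MvPolynomial σ ℝ)) = MvPolynomial.C ((m : ℝ) + 1) := by simp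
      rw [this]
      have h3 : MvPolynomial.C (((m : ℝ) + 1)⁻¹) * MvPolynomial.C ((m : ℝ) + 1)
          = (1 : MvPolynomial σ ℝ) := by rw [← map_mul, inv_mul_cancel₀ hm, map_one]
      linear_combination (-(ℓ ^ m * MvPolynomial.X i)) * h3
  rw [eq_top_iff]
  intro p _
  induction p using MvPolynomial.induction_on with
  | C a =>
    have h1 : (1 : MvPolynomial σ ℝ) ∈ V := Submodule.subset_span ⟨0, 0, by simp⟩
    have := V.smul_mem a h1
    rwa [MvPolynomial.smul_eq_C_mul, mul_one] at this
  | add p q hp hq => exact V.add_mem (hp trivial) (hq trivial)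
  | mul_X p i hp => exact hmul p i (hp trivial)

end Polarization

/-! ### Moments of the one-dimensional Gaussian -/

/-- Each factor x is a derivative in t of the moment generating function exp(v t² / 2), which is
finite everywhere. Its first derivative is v t times itself, and differentiating this relation
repeatedly gives the recursion. The parameter t is needed only for this; it is set to 0 afterwards.
-/
lemma integral_pow_mul_exp_gaussianReal (v : NNReal) (n : ℕ) (t : ℝ) :
    ∫ x, x ^ (n + 2) * Real.exp (t * x) ∂gaussianReal 0 v =
      v * t * ∫ x, x ^ (n + 1) * Real.exp (t * x) ∂gaussianReal 0 v +
      (n + 1) * v * ∫ x, x ^ n * Real.exp (t * x) ∂gaussianReal 0 v := by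
  have hint : ∀ t : ℝ, t ∈ interior (integrableExpSet id (gaussianReal 0 v)) := by
    simp [integrableExpSet_id_gaussianReal]
  have hd : ∀ (n : ℕ) (t : ℝ), HasDerivAt
      (fun t => ∫ x, x ^ n * Real.exp (t * x) ∂gaussianReal 0 v)
      (∫ x, x ^ (n + 1) * Real.exp (t * x) ∂gaussianReal 0 v) t :=
    fun n t => hasDerivAt_integral_pow_mul_exp_real (X := id) (hint t) n
  have h0 : ∀ t : ℝ, ∫ x, x ^ 0 * Real.exp (t * x) ∂gaussianReal 0 v =
      Real.exp (v * t ^ 2 / 2) := by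
    intro t
    have := mgf_gaussianReal (p := gaussianReal 0 v) (X := id) (by rw [Measure.map_id]) t
    simpa [mgf] using this
  have h1 : ∀ t : ℝ, ∫ x, x ^ 1 * Real.exp (t * x) ∂gaussianReal 0 v =
      v * t * ∫ x, x ^ 0 * Real.exp (t * x) ∂gaussianReal 0 v := by
    intro t
    have h2 := hd 0 t
    simp only [h0] at h2 ⊢
    have h3 : HasDerivAt (fun t : ℝ => Real.exp (v * t ^ 2 / 2))
        (Real.exp (v * t ^ 2 / 2) * (v * (2 * t) / 2)) t := by
      have := (((hasDerivAt_pow 2 t).const_mul (v : ℝ)).div_const 2).exp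
      simpa using this
    rw [h2.unique h3]
    ring
  induction n generalizing t with
  | zero =>
    have h2 := hd 1 t
    rw [funext h1] at h2
    rw [h2.unique (((hasDerivAt_id t).const_mul (v : ℝ)).mul (hd 0 t))]
    simp
    ring
  | succ n ih =>
    have h2 := hd (n + 2) t
    rw [funext ih] at h2
    rw [h2.unique ((((hasDerivAt_id t).const_mul (v : ℝ)).mul (hd (n + 1) t)).add
      ((hd n t).const_mul ((n + 1) * v : ℝ)))]
    push_cast
    simp only [id]
    ring

/-- The recursion for the moments of a centered Gaussian variable. -/
lemma integral_pow_add_two_gaussianReal (v : NNReal) (n : ℕ) :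
    ∫ x, x ^ (n + 2) ∂gaussianReal 0 v = (n + 1) * v * ∫ x, x ^ n ∂gaussianReal 0 v := by
  simpa using integral_pow_mul_exp_gaussianReal v n 0

/-! ### Integrability and integration by parts for a Gaussian field -/

section Field

variable {Ω : Type*} [MeasurableSpace Ω] {P : Measure Ω}
variable {L : Type*} [NormedAddCommGroup L] [InnerProductSpace ℝ L]
variable {Φ : L →ₗ[ℝ] Lp ℝ 2 P}

/-- Hölder with exponents 2q, 2q. Asking for all finite exponents makes the class stable under
products, so polynomials in the field can be treated by induction. -/
lemma MemLp.mul_of_forall {f g : Ω → ℝ} (hf : ∀ q : ENNReal, q ≠ ⊤ → MemLp f q P)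
    (hg : ∀ q : ENNReal, q ≠ ⊤ → MemLp g q P) (q : ENNReal) (hq : q ≠ ⊤) :
    MemLp (fun ω => f ω * g ω) q P := by
  have h2 : q * 2 ≠ ⊤ := ENNReal.mul_ne_top hq (by simp)
  have : ENNReal.HolderTriple (q * 2) (q * 2) q := by
    constructor
    rw [ENNReal.mul_inv (by simp) (by simp), ← mul_add, ENNReal.inv_two_add_inv_two, mul_one]
  exact MemLp.mul' (hg _ h2) (hf _ h2)

namespace IsGaussianField

variable (hΦ : IsGaussianField Φ)
include hΦ

lemma hasGaussianLaw (h : L) : HasGaussianLaw (Φ h) P :=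
  hΦ.isGaussianProcess.hasGaussianLaw_eval h

lemma memLp (h : L) {q : ENNReal} (hq : q ≠ ⊤) : MemLp (Φ h) q P :=
  (hΦ.hasGaussianLaw h).memLp hq

lemma memLp_polyFun {n : ℕ} (h : Fin n → L) (p : MvPolynomial (Fin n) ℝ) (q : ENNReal)
    (hq : q ≠ ⊤) : MemLp (polyFun Φ h p) q P := by
  have := hΦ.isGaussianProcess.isProbabilityMeasure
  induction p using MvPolynomial.induction_on generalizing q with
  | C a =>
    have : polyFun Φ h (MvPolynomial.C a) = fun _ => a := by
      ext ω; simp [polyFun]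
    rw [this]
    exact memLp_const a
  | add p p' hp hp' =>
    have : polyFun Φ h (p + p') = polyFun Φ h p + polyFun Φ h p' := by
      ext ω; simp [polyFun]
    rw [this]
    exact (hp q hq).add (hp' q hq)
  | mul_X p i hp =>
    have : polyFun Φ h (p * MvPolynomial.X i) = fun ω => polyFun Φ h p ω * Φ (h i) ω := by
      ext ω; simp [polyFun]
    rw [this]
    exact MemLp.mul_of_forall hp (fun q hq => hΦ.memLp (h i) hq) q hq

lemma memLp_gradFun {n : ℕ} (h : Fin n → L) (p : MvPolynomial (Fin n) ℝ) (q : ENNReal)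
    (hq : q ≠ ⊤) : MemLp (gradFun Φ h p) q P := by
  have : gradFun Φ h p =
      fun ω => ∑ j, polyFun Φ h (MvPolynomial.pderiv j p) ω • h j := rfl
  rw [this]
  exact memLp_finsetSum _ fun j _ =>
    ((ContinuousLinearMap.toSpanSingleton ℝ (h j)).comp_memLp'
      (hΦ.memLp_polyFun h (MvPolynomial.pderiv j p) q hq))

lemma memLp_pow (h : L) (n : ℕ) {q : ENNReal} (hq : q ≠ ⊤) :
    MemLp (fun ω => Φ h ω ^ n) q P := by
  have := hΦ.memLp_polyFun (n := 1) (fun _ => h) (MvPolynomial.X 0 ^ n) q hq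
  convert this using 2
  simp [polyFun]

lemma map_eq_gaussianReal (h : L) :
    P.map (Φ h) = gaussianReal 0 (‖h‖ ^ 2).toNNReal := by
  have := hΦ.isGaussianProcess.isProbabilityMeasure
  have hlaw := (hΦ.hasGaussianLaw h).map_eq_gaussianReal
  have hm : P[Φ h] = 0 := hΦ.mean h
  have hv : Var[Φ h; P] = ‖h‖ ^ 2 := by
    rw [variance_of_integral_eq_zero (hΦ.hasGaussianLaw h).aemeasurable hm,
      ← real_inner_self_eq_norm_sq, ← hΦ.covariance]
    simp [sq]
  rw [hlaw, hm, hv]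

lemma integral_pow_add_two (h : L) (n : ℕ) :
    ∫ ω, Φ h ω ^ (n + 2) ∂P = (n + 1) * ‖h‖ ^ 2 * ∫ ω, Φ h ω ^ n ∂P := by
  have key : ∀ m : ℕ, ∫ ω, Φ h ω ^ m ∂P =
      ∫ x, x ^ m ∂gaussianReal 0 (‖h‖ ^ 2).toNNReal := by
    intro m
    rw [← hΦ.map_eq_gaussianReal h, integral_map (hΦ.hasGaussianLaw h).aemeasurable (by fun_prop)]
  rw [key, key, integral_pow_add_two_gaussianReal, Real.coe_toNNReal _ (by positivity)]

lemma indepFun {h k : L} (hk : ⟪h, k⟫ = 0) : IndepFun (Φ h) (Φ k) P := by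
  have := hΦ.isGaussianProcess.isProbabilityMeasure
  apply (hΦ.isGaussianProcess.hasGaussianLaw_prodMk (s := h) (t := k)).indepFun_of_covariance_eq_zero
  have hm : ∀ h, P[Φ h] = 0 := hΦ.mean
  have hc : P[(Φ h : Ω → ℝ) * (Φ k : Ω → ℝ)] = ⟪h, k⟫ := hΦ.covariance h k
  rw [covariance_eq_sub (hΦ.memLp h (by simp)) (hΦ.memLp k (by simp)), hm, hm, hc, hk]
  simp

/-- Gaussian integration by parts for powers. -/
lemma integral_mul_pow (h k : L) (n : ℕ) :
    ∫ ω, Φ k ω * Φ h ω ^ n ∂P = n * ⟪h, k⟫ * ∫ ω, Φ h ω ^ (n - 1) ∂P := by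
  have := hΦ.isGaussianProcess.isProbabilityMeasure
  by_cases h0 : h = 0
  · have hz : (Φ h : Ω → ℝ) =ᵐ[P] 0 := by rw [h0, map_zero]; exact Lp.coeFn_zero _ _ _
    cases n with
    | zero => simpa using hΦ.mean k
    | succ n =>
      simp only [h0, inner_zero_left, mul_zero, zero_mul]
      rw [← h0]
      apply integral_eq_zero_of_ae
      filter_upwards [hz] with ω hω
      simp [hω]
  -- Coefficient of the orthogonal projection of k onto h; the case h = 0 was set aside because of
  -- this division.
  set c : ℝ := ⟪h, k⟫ / ‖h‖ ^ 2 with hc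
  have hn : ‖h‖ ^ 2 ≠ 0 := by positivity
  have hperp : ⟪k - c • h, h⟫ = 0 := by
    rw [inner_sub_left, real_inner_smul_left, real_inner_self_eq_norm_sq, hc, div_mul_cancel₀ _ hn,
      real_inner_comm, sub_self]
  have hae : (Φ k : Ω → ℝ) =ᵐ[P] fun ω => Φ (k - c • h) ω + c * Φ h ω := by
    have h1 : Φ k = Φ (k - c • h) + c • Φ h := by rw [← map_smul, ← map_add, sub_add_cancel]
    have h2 := Lp.coeFn_add (Φ (k - c • h)) (c • Φ h)
    have h3 := Lp.coeFn_smul c (Φ h)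
    rw [← h1] at h2
    filter_upwards [h2, h3] with ω e2 e3
    rw [e2, Pi.add_apply, e3]; rfl
  have hind : ∫ ω, Φ (k - c • h) ω * Φ h ω ^ n ∂P = 0 := by
    have hi := (hΦ.indepFun hperp).comp measurable_id (measurable_id.pow_const n)
    have := hi.integral_fun_mul_eq_mul_integral (hΦ.memLp (k - c • h) (q := 1) (by simp)).1
      (hΦ.memLp_pow h n (q := 1) (by simp)).1
    simp only [Function.comp_def, id] at this
    rw [this, hΦ.mean, zero_mul]
  have hI1 : Integrable (fun ω => Φ (k - c • h) ω * Φ h ω ^ n) P :=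
    memLp_one_iff_integrable.1 (MemLp.mul_of_forall (fun q hq => hΦ.memLp _ hq)
      (fun q hq => hΦ.memLp_pow h n hq) 1 (by simp))
  have hI2 : Integrable (fun ω => c * Φ h ω ^ (n + 1)) P :=
    (memLp_one_iff_integrable.1 (hΦ.memLp_pow h (n + 1) (by simp))).const_mul c
  have hsplit : ∫ ω, Φ k ω * Φ h ω ^ n ∂P = c * ∫ ω, Φ h ω ^ (n + 1) ∂P := by
    rw [← integral_const_mul, ← zero_add (∫ ω, c * Φ h ω ^ (n + 1) ∂P), ← hind,
      ← integral_add hI1 hI2]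
    apply integral_congr_ae
    filter_upwards [hae] with ω hω
    rw [hω]; ring
  rw [hsplit]
  -- For n = 0 the truncated exponent n - 1 is harmless: the right side has the factor n, and the
  -- left side is a mean.
  cases n with
  | zero => simpa using Or.inr (hΦ.mean h)
  | succ n =>
    rw [hΦ.integral_pow_add_two, hc, Nat.add_sub_cancel]
    push_cast
    field_simp

end IsGaussianField

lemma polyFun_add {n : ℕ} (h : Fin n → L) (p q : MvPolynomial (Fin n) ℝ) (ω : Ω) :
    polyFun Φ h (p + q) ω = polyFun Φ h p ω + polyFun Φ h q ω := by simp [polyFun]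

lemma polyFun_mul {n : ℕ} (h : Fin n → L) (p q : MvPolynomial (Fin n) ℝ) (ω : Ω) :
    polyFun Φ h (p * q) ω = polyFun Φ h p ω * polyFun Φ h q ω := by simp [polyFun]

lemma polyFun_smul {n : ℕ} (h : Fin n → L) (a : ℝ) (p : MvPolynomial (Fin n) ℝ) (ω : Ω) :
    polyFun Φ h (a • p) ω = a * polyFun Φ h p ω := by simp [polyFun]

lemma gradFun_add {n : ℕ} (h : Fin n → L) (p q : MvPolynomial (Fin n) ℝ) (ω : Ω) :
    gradFun Φ h (p + q) ω = gradFun Φ h p ω + gradFun Φ h q ω := by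
  simp [gradFun, polyFun_add, add_smul, Finset.sum_add_distrib]

lemma gradFun_smul {n : ℕ} (h : Fin n → L) (a : ℝ) (p : MvPolynomial (Fin n) ℝ) (ω : Ω) :
    gradFun Φ h (a • p) ω = a • gradFun Φ h p ω := by
  simp [gradFun, polyFun_smul, mul_smul, Finset.smul_sum]

lemma gradFun_mul {n : ℕ} (h : Fin n → L) (p q : MvPolynomial (Fin n) ℝ) (ω : Ω) :
    gradFun Φ h (p * q) ω =
      polyFun Φ h p ω • gradFun Φ h q ω + polyFun Φ h q ω • gradFun Φ h p ω := by
  simp only [gradFun, Derivation.leibniz, smul_eq_mul, polyFun_add, polyFun_mul, add_smul,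
    Finset.sum_add_distrib, Finset.smul_sum, mul_smul]

lemma coeFn_sum_smul {ι : Type*} [Fintype ι] (h : ι → L) (c : ι → ℝ) :
    ∀ᵐ ω ∂P, Φ (∑ i, c i • h i) ω = ∑ i, c i * Φ (h i) ω := by
  rw [map_sum]
  have h2 := Lp.coeFn_finsetSum Finset.univ (fun i => Φ (c i • h i))
  have h3 : ∀ᵐ ω ∂P, ∀ i, Φ (c i • h i) ω = c i * Φ (h i) ω := by
    rw [ae_all_iff]
    intro i
    rw [map_smul]
    exact Lp.coeFn_smul (c i) (Φ (h i))
  filter_upwards [h2, h3] with ω e2 e3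
  rw [e2]
  simp only [Finset.sum_apply, e3]

lemma polyFun_linearForm_pow {n : ℕ} (h : Fin n → L) (c : Fin n → ℝ) (m : ℕ) :
    polyFun Φ h ((∑ i, MvPolynomial.C (c i) * MvPolynomial.X i) ^ m) =ᵐ[P]
      fun ω => Φ (∑ i, c i • h i) ω ^ m := by
  filter_upwards [coeFn_sum_smul (Φ := Φ) h c] with ω hω
  rw [hω]
  simp [polyFun]

lemma gradFun_linearForm_pow {n : ℕ} (h : Fin n → L) (c : Fin n → ℝ) (m : ℕ) :
    gradFun Φ h ((∑ i, MvPolynomial.C (c i) * MvPolynomial.X i) ^ m) =ᵐ[P]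
      fun ω => (m * Φ (∑ i, c i • h i) ω ^ (m - 1)) • ∑ i, c i • h i := by
  filter_upwards [polyFun_linearForm_pow (Φ := Φ) h c (m - 1)] with ω hω
  have hd : ∀ j, MvPolynomial.pderiv j (∑ i, MvPolynomial.C (c i) * MvPolynomial.X i) =
      MvPolynomial.C (c j) := by
    intro j
    simp [MvPolynomial.pderiv_X, Pi.single_apply, Derivation.leibniz]
  rw [← hω, gradFun, Finset.smul_sum]
  refine Finset.sum_congr rfl fun j _ => ?_
  rw [Derivation.leibniz_pow, hd, smul_smul]
  congr 1
  simp [polyFun]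
  ring

/-- Gaussian integration by parts for polynomials. -/
lemma IsGaussianField.integral_mul_polyFun (hΦ : IsGaussianField Φ) {n : ℕ} (h : Fin n → L)
    (p : MvPolynomial (Fin n) ℝ) (k : L) :
    ∫ ω, Φ k ω * polyFun Φ h p ω ∂P = ∫ ω, ⟪gradFun Φ h p ω, k⟫ ∂P := by
  -- Both sides are linear in p, and by linearity of Φ a power of a linear form becomes a power of a
  -- single variable Φ(g).
  have hp : p ∈ Submodule.span ℝ {p : MvPolynomial (Fin n) ℝ | ∃ (c : Fin n → ℝ) (m : ℕ),
      p = (∑ i, MvPolynomial.C (c i) * MvPolynomial.X i) ^ m} := by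
    rw [span_pow_linearForm_eq_top]; trivial
  have hi1 : ∀ p, Integrable (fun ω => Φ k ω * polyFun Φ h p ω) P := fun p =>
    memLp_one_iff_integrable.1 (MemLp.mul_of_forall (fun q hq => hΦ.memLp _ hq)
      (hΦ.memLp_polyFun h p) 1 (by simp))
  have hi2 : ∀ p, Integrable (fun ω => ⟪gradFun Φ h p ω, k⟫) P := fun p =>
    (memLp_one_iff_integrable.1 (hΦ.memLp_gradFun h p 1 (by simp))).inner_const k
  induction hp using Submodule.span_induction with
  | zero =>
    have h1 : ∀ ω, polyFun Φ h 0 ω = 0 := fun ω => by simp [polyFun]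
    have h2 : ∀ ω, gradFun Φ h 0 ω = 0 := fun ω => by simp [gradFun, h1]
    simp [h1, h2]
  | add p q _ _ hp hq =>
    simp only [polyFun_add, gradFun_add, mul_add, inner_add_left]
    rw [integral_add (hi1 p) (hi1 q), integral_add (hi2 p) (hi2 q), hp, hq]
  | smul a p _ hp =>
    simp only [polyFun_smul, gradFun_smul, mul_left_comm _ a, real_inner_smul_left]
    rw [integral_const_mul, integral_const_mul, hp]
  | mem p hp =>
    obtain ⟨c, m, rfl⟩ := hp
    set g := ∑ i, c i • h i
    have e1 : ∫ ω, Φ k ω * polyFun Φ h ((∑ i, MvPolynomial.C (c i) * MvPolynomial.X i) ^ m) ω ∂P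
        = ∫ ω, Φ k ω * Φ g ω ^ m ∂P := by
      apply integral_congr_ae
      filter_upwards [polyFun_linearForm_pow (Φ := Φ) h c m] with ω hω
      rw [hω]
    have e2 : ∫ ω, ⟪gradFun Φ h ((∑ i, MvPolynomial.C (c i) * MvPolynomial.X i) ^ m) ω, k⟫ ∂P
        = ∫ ω, m * ⟪g, k⟫ * Φ g ω ^ (m - 1) ∂P := by
      apply integral_congr_ae
      filter_upwards [gradFun_linearForm_pow (Φ := Φ) h c m] with ω hω
      rw [hω, real_inner_smul_left]
      ring
    rw [e1, e2, hΦ.integral_mul_pow, integral_const_mul]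

end Field

/-! ### Totality of the powers Φ(h)ⁿ in L² -/

section Density

variable {Ω : Type*} [MeasurableSpace Ω] {P : Measure Ω}
variable {L : Type*} [NormedAddCommGroup L] [InnerProductSpace ℝ L]
variable {Φ : L →ₗ[ℝ] Lp ℝ 2 P}

/-- This product is the dominating function that allows the exponential series to be integrated term
by term against f. -/
lemma IsGaussianField.integrable_mul_exp_abs (hΦ : IsGaussianField Φ) (f : Lp ℝ 2 P) (h : L) :
    Integrable (fun ω => |f ω| * Real.exp |Φ h ω|) P := by
  have hX : AEMeasurable (Φ h) P := (hΦ.hasGaussianLaw h).aemeasurable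
  have he : ∀ t : ℝ, Integrable (fun ω => Real.exp (t * Φ h ω)) P := by
    intro t
    have := integrable_exp_mul_gaussianReal (μ := 0) (v := (‖h‖ ^ 2).toNNReal) t
    rw [← hΦ.map_eq_gaussianReal h] at this
    exact this.comp_aemeasurable hX
  have h2 : MemLp (fun ω => Real.exp |Φ h ω|) 2 P := by
    rw [memLp_two_iff_integrable_sq (by fun_prop)]
    refine (integrable_exp_mul_abs (he 2) (he (-2))).congr ?_
    filter_upwards with ω
    rw [← Real.exp_nat_mul]
    norm_num
  exact (Lp.memLp f).abs.integrable_mul h2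

/-- If all moments `E (f (Φ h)ⁿ)` vanish then so do all `E (f exp (i Φ h))`. -/
lemma IsGaussianField.integral_mul_cexp_eq_zero (hΦ : IsGaussianField Φ) (f : Lp ℝ 2 P) (h : L)
    (hf : ∀ n : ℕ, ∫ ω, f ω * Φ h ω ^ n ∂P = 0) :
    ∫ ω, (f ω : ℂ) * Complex.exp (Φ h ω * Complex.I) ∂P = 0 := by
  have hX : AEMeasurable (Φ h) P := (hΦ.hasGaussianLaw h).aemeasurable
  have hfm : AEMeasurable f P := (Lp.memLp f).1.aemeasurable
  have hsum : ∀ x : ℝ, HasSum (fun n : ℕ => x ^ n / n.factorial) (Real.exp x) := by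
    intro x
    rw [Real.exp_eq_exp_ℝ]
    exact NormedSpace.expSeries_div_hasSum_exp x
  have hsumC : ∀ z : ℂ, HasSum (fun n : ℕ => z ^ n / n.factorial) (Complex.exp z) := by
    intro z
    rw [Complex.exp_eq_exp_ℂ]
    exact NormedSpace.expSeries_div_hasSum_exp z
  have key := hasSum_integral_of_dominated_convergence (μ := P)
    (F := fun (n : ℕ) ω => (f ω : ℂ) * ((Φ h ω * Complex.I) ^ n / n.factorial))
    (f := fun ω => (f ω : ℂ) * Complex.exp (Φ h ω * Complex.I))
    (fun n ω => |f ω| * (|Φ h ω| ^ n / n.factorial))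
    (fun n => by
      apply AEMeasurable.aestronglyMeasurable
      fun_prop)
    (fun n => by
      filter_upwards with ω
      simp)
    (by
      filter_upwards with ω
      exact ((hsum _).mul_left _).summable)
    (by
      refine (hΦ.integrable_mul_exp_abs f h).congr ?_
      filter_upwards with ω
      exact ((hsum _).mul_left _).tsum_eq.symm)
    (by
      filter_upwards with ω
      exact (hsumC _).mul_left _)
  have hz : ∀ n : ℕ,
      ∫ ω, (f ω : ℂ) * ((Φ h ω * Complex.I) ^ n / n.factorial) ∂P = 0 := by
    intro n
    have : ∀ ω, (f ω : ℂ) * ((Φ h ω * Complex.I) ^ n / n.factorial) =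
        (Complex.I ^ n / n.factorial) * ((f ω * Φ h ω ^ n : ℝ) : ℂ) := by
      intro ω
      push_cast
      ring
    simp only [this]
    rw [integral_const_mul, integral_complex_ofReal, hf]
    simp
  simp only [hz] at key
  exact key.unique hasSum_zero

/-- Trades the signed density f for two positive measures, to which uniqueness theorems for
characteristic functions and projective limits apply. -/
lemma integral_withDensity_ofReal_sub {f : Ω → ℝ} (hf : Measurable f) (hfi : Integrable f P)
    {g : Ω → ℂ} (hg : AEStronglyMeasurable g P) (hb : ∀ ω, ‖g ω‖ ≤ 1) :
    ∫ ω, g ω ∂(P.withDensity fun ω => ENNReal.ofReal (f ω)) -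
      ∫ ω, g ω ∂(P.withDensity fun ω => ENNReal.ofReal (-f ω)) = ∫ ω, (f ω : ℂ) * g ω ∂P := by
  rw [integral_withDensity_eq_integral_toReal_smul (by fun_prop) (by simp),
    integral_withDensity_eq_integral_toReal_smul (by fun_prop) (by simp), ← integral_sub]
  · apply integral_congr_ae
    filter_upwards with ω
    rw [← sub_smul, ENNReal.toReal_ofReal', ENNReal.toReal_ofReal', max_zero_sub_eq_self,
      Complex.real_smul]
  · refine Integrable.smul_bdd ?_ 1 hg ?_
    · simpa [ENNReal.toReal_ofReal'] using hfi.pos_part.ofReal (𝕜 := ℂ)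
    · filter_upwards with ω using hb ω
  · refine Integrable.smul_bdd ?_ 1 hg ?_
    · simpa [ENNReal.toReal_ofReal'] using hfi.neg_part.ofReal (𝕜 := ℂ)
    · filter_upwards with ω using hb ω

/-- A square integrable function which is orthogonal to all powers `(Φ h)ⁿ` vanishes. -/
lemma IsGaussianField.eq_zero_of_forall_integral_mul_pow_eq_zero (hΦ : IsGaussianField Φ)
    (hgen : GeneratesSigmaAlgebra Φ) (f : Lp ℝ 2 P)
    (hf : ∀ (h : L) (n : ℕ), ∫ ω, f ω * Φ h ω ^ n ∂P = 0) : f = 0 := by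
  have := hΦ.isGaussianProcess.isProbabilityMeasure
  have hfi : Integrable f P := (Lp.memLp f).integrable (by norm_num)
  have hfm : Measurable f := (Lp.stronglyMeasurable f).measurable
  have hm : ∀ h, Measurable (Φ h) := fun h => (Lp.stronglyMeasurable (Φ h)).measurable
  have hmp : Measurable (fun ω (h : L) => Φ h ω) := measurable_pi_lambda _ hm
  let νp := P.withDensity fun ω => ENNReal.ofReal (f ω)
  let νm := P.withDensity fun ω => ENNReal.ofReal (-f ω)
  have : IsFiniteMeasure νp := isFiniteMeasure_withDensity_ofReal hfi.2
  have : IsFiniteMeasure νm := isFiniteMeasure_withDensity_ofReal hfi.neg.2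
  have hfin : ∀ I : Finset L, νp.map (fun ω => I.restrict (fun h => Φ h ω)) =
      νm.map (fun ω => I.restrict (fun h => Φ h ω)) := by
    intro I
    classical
    have hmI : Measurable (fun ω => I.restrict (fun h => Φ h ω)) :=
      (Finset.measurable_restrict I).comp hmp
    apply Measure.ext_of_charFunDual
    ext ℓ
    have hmℓ : Measurable (fun ω => ℓ (I.restrict (fun h => Φ h ω))) :=
      ℓ.measurable.comp hmI
    rw [charFunDual_apply, charFunDual_apply, integral_map hmI.aemeasurable (by fun_prop),
      integral_map hmI.aemeasurable (by fun_prop), ← sub_eq_zero,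
      integral_withDensity_ofReal_sub hfm hfi (by
          apply Measurable.aestronglyMeasurable; fun_prop)
        (fun ω => (Complex.norm_exp_ofReal_mul_I _).le)]
    -- A functional of finitely many coordinates of the field is almost surely one variable Φ(g),
    -- where g combines the indices with the coefficients of the functional.
    rw [← hΦ.integral_mul_cexp_eq_zero f (∑ i : I, ℓ (Pi.single i 1) • (i : L)) (hf _)]
    apply integral_congr_ae
    filter_upwards [coeFn_sum_smul (Φ := Φ) (fun i : I => (i : L))
      (fun i => ℓ (Pi.single i 1))] with ω hω
    rw [hω]
    have : ℓ (I.restrict fun h => Φ h ω) = ∑ i : I, ℓ (Pi.single i 1) * Φ (i : L) ω := by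
      conv_lhs => rw [pi_eq_sum_univ' (I.restrict fun h => Φ h ω)]
      rw [map_sum]
      refine Finset.sum_congr rfl fun i _ => ?_
      rw [map_smul, smul_eq_mul, mul_comm]
      simp only [Finset.restrict]
    rw [this]
  have hmap : νp.map (fun ω (h : L) => Φ h ω) = νm.map (fun ω (h : L) => Φ h ω) := by
    have h1 := isProjectiveLimit_map (P := νp) (X := fun h ω => Φ h ω) hmp.aemeasurable
    simp_rw [hfin] at h1
    exact h1.unique (isProjectiveLimit_map hmp.aemeasurable)
  have hset : ∀ A : Set Ω, MeasurableSet A → ∫ ω in A, f ω ∂P = 0 := by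
    intro A hA
    obtain ⟨B, hB, hAB⟩ := hgen A hA
    have hσ : (⨆ h : L, MeasurableSpace.comap (fun ω => Φ h ω) (borel ℝ)) =
        MeasurableSpace.comap (fun ω (h : L) => Φ h ω) MeasurableSpace.pi := by
      rw [MeasurableSpace.pi, MeasurableSpace.comap_iSup]
      simp only [MeasurableSpace.comap_comp, Function.comp_def]
      rfl
    rw [hσ] at hB
    obtain ⟨C, hC, rfl⟩ := hB
    rw [setIntegral_congr_set hAB,
      integral_eq_lintegral_pos_part_sub_lintegral_neg_part hfi.integrableOn,
      ← withDensity_apply _ (hmp hC), ← withDensity_apply _ (hmp hC), ← Measure.map_apply hmp hC,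
      ← Measure.map_apply hmp hC]
    change ((νp.map _) C).toReal - ((νm.map _) C).toReal = 0
    rw [hmap, sub_self]
  have h0 := hfi.ae_eq_zero_of_forall_setIntegral_eq_zero (fun A hA _ => hset A hA)
  exact (Lp.eq_zero_iff_ae_eq_zero).2 h0

end Density

/-! ### The graphs of T and S, and their maximality -/

section Operators

variable {Ω : Type*} [MeasurableSpace Ω] {P : Measure Ω}
variable {L : Type*} [NormedAddCommGroup L] [InnerProductSpace ℝ L]

/-- The graph of the Malliavin derivative. -/
def derivativeGraph (Φ : L →ₗ[ℝ] Lp ℝ 2 P) : Submodule ℝ (Lp ℝ 2 P × Lp L 2 P) :=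
  Submodule.span ℝ {x : Lp ℝ 2 P × Lp L 2 P |
    ∃ (n : ℕ) (h : Fin n → L) (p : MvPolynomial (Fin n) ℝ),
      x.1 =ᵐ[P] polyFun Φ h p ∧ x.2 =ᵐ[P] gradFun Φ h p}

/-- The graph of the companion operator. -/
def companionGraph (Φ : L →ₗ[ℝ] Lp ℝ 2 P) : Submodule ℝ (Lp L 2 P × Lp ℝ 2 P) :=
  Submodule.span ℝ {x : Lp L 2 P × Lp ℝ 2 P |
    ∃ (F : (malliavinDerivative Φ).domain) (k : L),
      x.1 = tensor (F : Lp ℝ 2 P) k ∧ x.2 =ᵐ[P] companionFun Φ F k}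

variable {Φ : L →ₗ[ℝ] Lp ℝ 2 P}

lemma coeFn_tensor (F : Lp ℝ 2 P) (k : L) : tensor F k =ᵐ[P] fun ω => F ω • k := by
  filter_upwards [(ContinuousLinearMap.toSpanSingleton ℝ k).coeFn_compLp F] with ω hω
  rw [tensor, hω, ContinuousLinearMap.toSpanSingleton_apply]

lemma polyFun_rename {n m : ℕ} {f : Fin n → Fin m} (h : Fin m → L)
    (p : MvPolynomial (Fin n) ℝ) :
    polyFun Φ h (MvPolynomial.rename f p) = polyFun Φ (h ∘ f) p := by
  ext ω
  simp [polyFun, MvPolynomial.eval_rename, Function.comp_def]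

lemma gradFun_rename {n m : ℕ} {f : Fin n → Fin m} (hf : Function.Injective f) (h : Fin m → L)
    (p : MvPolynomial (Fin n) ℝ) :
    gradFun Φ h (MvPolynomial.rename f p) = gradFun Φ (h ∘ f) p := by
  ext ω
  symm
  apply Fintype.sum_of_injective f hf
  · intro i hi
    have : MvPolynomial.pderiv i (MvPolynomial.rename f p) = 0 := by
      apply MvPolynomial.pderiv_eq_zero_of_notMem_vars
      intro hmem
      classical
      have := MvPolynomial.vars_rename f p hmem
      rw [Finset.mem_image] at this
      obtain ⟨a, _, rfl⟩ := this
      exact hi ⟨a, rfl⟩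
    simp [this, polyFun]
  · intro i
    rw [MvPolynomial.pderiv_rename hf, polyFun_rename]
    rfl

/-- Two polynomial fields together with their gradients may be written with the same vectors. -/
lemma exists_common_vectors {n m : ℕ} (h : Fin n → L) (g : Fin m → L)
    (p : MvPolynomial (Fin n) ℝ) (q : MvPolynomial (Fin m) ℝ) :
    ∃ (e : Fin (n + m) → L) (p' q' : MvPolynomial (Fin (n + m)) ℝ),
      polyFun Φ h p = polyFun Φ e p' ∧ gradFun Φ h p = gradFun Φ e p' ∧
      polyFun Φ g q = polyFun Φ e q' ∧ gradFun Φ g q = gradFun Φ e q' := by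
  refine ⟨Fin.append h g, MvPolynomial.rename (Fin.castAdd m) p,
    MvPolynomial.rename (Fin.natAdd n) q, ?_⟩
  have h1 : Fin.append h g ∘ Fin.castAdd m = h := by ext i; simp
  have h2 : Fin.append h g ∘ Fin.natAdd n = g := by ext i; simp
  rw [polyFun_rename, polyFun_rename, gradFun_rename (Fin.castAdd_injective n m),
    gradFun_rename (Fin.natAdd_injective m n), h1, h2]
  exact ⟨rfl, rfl, rfl, rfl⟩

/-- The generating set is already a subspace: a sum of two generators is a generator once both
polynomials use a common list of vectors. -/
lemma mem_derivativeGraph_iff {x : Lp ℝ 2 P × Lp L 2 P} :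
    x ∈ derivativeGraph Φ ↔ ∃ (n : ℕ) (h : Fin n → L) (p : MvPolynomial (Fin n) ℝ),
      x.1 =ᵐ[P] polyFun Φ h p ∧ x.2 =ᵐ[P] gradFun Φ h p := by
  refine ⟨fun hx => ?_, fun hx => Submodule.subset_span hx⟩
  induction hx using Submodule.span_induction with
  | mem x hx => exact hx
  | zero =>
    refine ⟨0, Fin.elim0, 0, ?_, ?_⟩
    · filter_upwards [Lp.coeFn_zero ℝ 2 P] with ω hω
      rw [Prod.fst_zero, hω]
      simp [polyFun]
    · filter_upwards [Lp.coeFn_zero L 2 P] with ω hω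
      rw [Prod.snd_zero, hω]
      simp [gradFun]
  | add x y _ _ hx hy =>
    obtain ⟨n, h, p, hx1, hx2⟩ := hx
    obtain ⟨m, g, q, hy1, hy2⟩ := hy
    obtain ⟨e, p', q', e1, e2, e3, e4⟩ := exists_common_vectors (Φ := Φ) h g p q
    rw [e1] at hx1
    rw [e2] at hx2
    rw [e3] at hy1
    rw [e4] at hy2
    refine ⟨_, e, p' + q', ?_, ?_⟩
    · filter_upwards [hx1, hy1, Lp.coeFn_add x.1 y.1] with ω h1 h2 h3
      rw [polyFun_add, Prod.fst_add, h3, Pi.add_apply, h1, h2]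
    · filter_upwards [hx2, hy2, Lp.coeFn_add x.2 y.2] with ω h1 h2 h3
      rw [gradFun_add, Prod.snd_add, h3, Pi.add_apply, h1, h2]
  | smul a x _ hx =>
    obtain ⟨n, h, p, hx1, hx2⟩ := hx
    refine ⟨n, h, a • p, ?_, ?_⟩
    · filter_upwards [hx1, Lp.coeFn_smul a x.1] with ω h1 h2
      rw [polyFun_smul, Prod.smul_fst, h2, Pi.smul_apply, h1, smul_eq_mul]
    · filter_upwards [hx2, Lp.coeFn_smul a x.2] with ω h1 h2
      rw [gradFun_smul, Prod.smul_snd, h2, Pi.smul_apply, h1]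

namespace IsGaussianField

variable (hΦ : IsGaussianField Φ)
include hΦ

lemma exists_mem_derivativeGraph {n : ℕ} (h : Fin n → L) (p : MvPolynomial (Fin n) ℝ) :
    ∃ x ∈ derivativeGraph Φ, x.1 =ᵐ[P] polyFun Φ h p ∧ x.2 =ᵐ[P] gradFun Φ h p := by
  have h1 := (hΦ.memLp_polyFun h p 2 (by simp)).coeFn_toLp
  have h2 := (hΦ.memLp_gradFun h p 2 (by simp)).coeFn_toLp
  exact ⟨(_, _), mem_derivativeGraph_iff.2 ⟨n, h, p, h1, h2⟩, h1, h2⟩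

/-- The power `(Φ h)ⁿ`, together with its derivative `n (Φ h)ⁿ⁻¹ ⊗ h`, belongs to the graph of the
Malliavin derivative. -/
lemma exists_pow_mem_derivativeGraph (h : L) (n : ℕ) :
    ∃ x ∈ derivativeGraph Φ, x.1 =ᵐ[P] (fun ω => Φ h ω ^ n) ∧
      x.2 =ᵐ[P] fun ω => (n * Φ h ω ^ (n - 1)) • h := by
  obtain ⟨x, hx, h1, h2⟩ := hΦ.exists_mem_derivativeGraph (n := 1) (fun _ => h)
    ((∑ i, MvPolynomial.C (1 : ℝ) * MvPolynomial.X i) ^ n)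
  refine ⟨x, hx, h1.trans ?_, h2.trans ?_⟩
  · simpa using polyFun_linearForm_pow (Φ := Φ) (n := 1) (fun _ => h) (fun _ => 1) n
  · simpa using gradFun_linearForm_pow (Φ := Φ) (n := 1) (fun _ => h) (fun _ => 1) n

lemma exists_companion_value {x : Lp ℝ 2 P × Lp L 2 P} (hx : x ∈ derivativeGraph Φ) (k : L) :
    ∃ y : Lp ℝ 2 P, y =ᵐ[P] fun ω => Φ k ω * x.1 ω - ⟪x.2 ω, k⟫ := by
  obtain ⟨n, h, p, h1, h2⟩ := mem_derivativeGraph_iff.1 hx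
  have hm : MemLp (fun ω => Φ k ω * polyFun Φ h p ω - ⟪gradFun Φ h p ω, k⟫) 2 P :=
    (MemLp.mul_of_forall (fun q hq => hΦ.memLp k hq) (hΦ.memLp_polyFun h p) 2 (by simp)).sub
      ((hΦ.memLp_gradFun h p 2 (by simp)).inner_const k)
  refine ⟨hm.toLp, hm.coeFn_toLp.trans ?_⟩
  filter_upwards [h1, h2] with ω e1 e2
  rw [e1, e2]

/-- Integration by parts for a product, expanded by Leibniz. It is phrased with graph elements
rather than values of T, because it is used to prove that T is single-valued. -/
lemma inner_tensor_eq {x z : Lp ℝ 2 P × Lp L 2 P} (hx : x ∈ derivativeGraph Φ)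
    (hz : z ∈ derivativeGraph Φ) (k : L) {y : Lp ℝ 2 P}
    (hy : y =ᵐ[P] fun ω => Φ k ω * z.1 ω - ⟪z.2 ω, k⟫) :
    ⟪x.2, tensor z.1 k⟫ = ⟪x.1, y⟫ := by
  obtain ⟨n, h, p, hx1, hx2⟩ := mem_derivativeGraph_iff.1 hx
  obtain ⟨m, g, q, hz1, hz2⟩ := mem_derivativeGraph_iff.1 hz
  obtain ⟨e, p', q', e1, e2, e3, e4⟩ := exists_common_vectors (Φ := Φ) h g p q
  rw [e1] at hx1
  rw [e2] at hx2
  rw [e3] at hz1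
  rw [e4] at hz2
  have hi : ∀ p q, Integrable (fun ω => polyFun Φ e q ω * ⟪gradFun Φ e p ω, k⟫) P :=
    fun p q => memLp_one_iff_integrable.1 (MemLp.mul_of_forall (hΦ.memLp_polyFun e q)
      (fun r hr => (hΦ.memLp_gradFun e p r hr).inner_const k) 1 (by simp))
  have hi' : Integrable (fun ω => Φ k ω * polyFun Φ e (p' * q') ω) P :=
    memLp_one_iff_integrable.1 (MemLp.mul_of_forall (fun q hq => hΦ.memLp k hq)
      (hΦ.memLp_polyFun e (p' * q')) 1 (by simp))
  have ibp := hΦ.integral_mul_polyFun e (p' * q') k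
  simp only [gradFun_mul, inner_add_left, real_inner_smul_left] at ibp
  rw [integral_add (hi q' p') (hi p' q')] at ibp
  have hl : ⟪x.2, tensor z.1 k⟫ = ∫ ω, polyFun Φ e q' ω * ⟪gradFun Φ e p' ω, k⟫ ∂P := by
    rw [L2.inner_def]
    apply integral_congr_ae
    filter_upwards [hx2, hz1, coeFn_tensor z.1 k] with ω w1 w2 w3
    rw [w3, w1, w2, real_inner_smul_right]
  have hr : ⟪x.1, y⟫ = ∫ ω, (Φ k ω * polyFun Φ e (p' * q') ω -
      polyFun Φ e p' ω * ⟪gradFun Φ e q' ω, k⟫) ∂P := by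
    rw [L2.inner_def]
    apply integral_congr_ae
    filter_upwards [hx1, hz1, hz2, hy] with ω w1 w2 w3 w4
    rw [w4, w1, w2, w3, polyFun_mul]
    simp only [RCLike.inner_apply, conj_trivial]
    ring
  rw [hl, hr, integral_sub hi' (hi q' p'), ibp]
  ring

lemma eq_zero_of_forall_inner_eq_zero (hgen : GeneratesSigmaAlgebra Φ) {f : Lp ℝ 2 P}
    (hf : ∀ x ∈ derivativeGraph Φ, ⟪x.1, f⟫ = 0) : f = 0 := by
  apply hΦ.eq_zero_of_forall_integral_mul_pow_eq_zero hgen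
  intro h n
  obtain ⟨x, hx, h1, -⟩ := hΦ.exists_pow_mem_derivativeGraph h n
  rw [← hf x hx, L2.inner_def]
  apply integral_congr_ae
  filter_upwards [h1] with ω hω
  rw [hω]
  simp

lemma eq_zero_of_forall_inner_tensor_eq_zero [CompleteSpace L] (hgen : GeneratesSigmaAlgebra Φ)
    {U : Lp L 2 P} (hU : ∀ x ∈ derivativeGraph Φ, ∀ k : L, ⟪U, tensor x.1 k⟫ = 0) : U = 0 := by
  have hk : ∀ k : L, (innerSL ℝ k).compLp U = 0 := by
    intro k
    apply hΦ.eq_zero_of_forall_inner_eq_zero hgen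
    intro x hx
    rw [← hU x hx k, L2.inner_def, L2.inner_def]
    apply integral_congr_ae
    filter_upwards [coeFn_tensor x.1 k, (innerSL ℝ k).coeFn_compLp U] with ω h1 h2
    rw [h1, h2, innerSL_apply_apply, real_inner_smul_right, real_inner_comm k]
    simp only [RCLike.inner_apply, conj_trivial]
    ring
  rw [Lp.eq_zero_iff_ae_eq_zero]
  -- The exceptional null set depends on k. Since L need not be separable, what allows passing to a
  -- single null set is the separable range of U.
  refine ae_eq_zero_of_forall_dual_of_isSeparable ℝ
    (Lp.stronglyMeasurable U).isSeparable_range (fun c => ?_)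
    (Filter.Eventually.of_forall fun ω => ⟨ω, rfl⟩)
  obtain ⟨k, rfl⟩ := (InnerProductSpace.toDual ℝ L).surjective c
  have h0 := Lp.eq_zero_iff_ae_eq_zero.1 (hk k)
  filter_upwards [h0, (innerSL ℝ k).coeFn_compLp U] with ω h1 h2
  rw [h2] at h1
  exact h1

/-- If the first component vanishes, formal adjointness makes the second orthogonal to every tensor
F ⊗ k, and these are total. -/
lemma derivativeGraph_singleValued [CompleteSpace L] (hgen : GeneratesSigmaAlgebra Φ)
    (x : Lp ℝ 2 P × Lp L 2 P) (hx : x ∈ derivativeGraph Φ) (h0 : x.1 = 0) : x.2 = 0 := by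
  apply hΦ.eq_zero_of_forall_inner_tensor_eq_zero hgen
  intro z hz k
  obtain ⟨y, hy⟩ := hΦ.exists_companion_value hz k
  rw [hΦ.inner_tensor_eq hx hz k hy, h0, inner_zero_left]

lemma graph_malliavinDerivative [CompleteSpace L] (hgen : GeneratesSigmaAlgebra Φ) :
    (malliavinDerivative Φ).graph = derivativeGraph Φ :=
  Submodule.toLinearPMap_graph_eq _ (hΦ.derivativeGraph_singleValued hgen)

lemma mem_derivativeGraph [CompleteSpace L] (hgen : GeneratesSigmaAlgebra Φ)
    (F : (malliavinDerivative Φ).domain) :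
    ((F : Lp ℝ 2 P), malliavinDerivative Φ F) ∈ derivativeGraph Φ := by
  rw [← hΦ.graph_malliavinDerivative hgen]
  exact LinearPMap.mem_graph _ F

lemma exists_domain_eq [CompleteSpace L] (hgen : GeneratesSigmaAlgebra Φ)
    {x : Lp ℝ 2 P × Lp L 2 P} (hx : x ∈ derivativeGraph Φ) :
    ∃ F : (malliavinDerivative Φ).domain, (F : Lp ℝ 2 P) = x.1 ∧ malliavinDerivative Φ F = x.2 := by
  rw [← hΦ.graph_malliavinDerivative hgen] at hx
  exact (LinearPMap.mem_graph_iff _).1 hx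

lemma tensor_mem_companionGraph [CompleteSpace L] (hgen : GeneratesSigmaAlgebra Φ)
    {x : Lp ℝ 2 P × Lp L 2 P} (hx : x ∈ derivativeGraph Φ) (k : L) {y : Lp ℝ 2 P}
    (hy : y =ᵐ[P] fun ω => Φ k ω * x.1 ω - ⟪x.2 ω, k⟫) :
    (tensor x.1 k, y) ∈ companionGraph Φ := by
  obtain ⟨F, h1, h2⟩ := hΦ.exists_domain_eq hgen hx
  refine Submodule.subset_span ⟨F, k, by rw [h1], ?_⟩
  refine hy.trans (Filter.Eventually.of_forall fun ω => ?_)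
  simp only [companionFun, h1, h2]

lemma inner_eq_inner_of_mem_graph [CompleteSpace L] (hgen : GeneratesSigmaAlgebra Φ)
    {x : Lp ℝ 2 P × Lp L 2 P} (hx : x ∈ derivativeGraph Φ)
    {y : Lp L 2 P × Lp ℝ 2 P} (hy : y ∈ companionGraph Φ) : ⟪x.2, y.1⟫ = ⟪x.1, y.2⟫ := by
  induction hy using Submodule.span_induction with
  | mem y hy =>
    obtain ⟨F, k, h1, h2⟩ := hy
    rw [h1]
    exact hΦ.inner_tensor_eq hx (hΦ.mem_derivativeGraph hgen F) k h2
  | zero => simp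
  | add y z _ _ hy hz => simp only [Prod.fst_add, Prod.snd_add, inner_add_right, hy, hz]
  | smul a y _ hy => simp only [Prod.smul_fst, Prod.smul_snd, real_inner_smul_right, hy]

lemma graph_companion [CompleteSpace L] (hgen : GeneratesSigmaAlgebra Φ) :
    (companion Φ).graph = companionGraph Φ := by
  apply Submodule.toLinearPMap_graph_eq
  intro y hy h0
  apply hΦ.eq_zero_of_forall_inner_eq_zero hgen
  intro x hx
  rw [← hΦ.inner_eq_inner_of_mem_graph hgen hx hy, h0, inner_zero_right]

lemma exists_companion_domain_eq [CompleteSpace L] (hgen : GeneratesSigmaAlgebra Φ)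
    {y : Lp L 2 P × Lp ℝ 2 P} (hy : y ∈ companionGraph Φ) :
    ∃ ψ : (companion Φ).domain, (ψ : Lp L 2 P) = y.1 ∧ companion Φ ψ = y.2 := by
  rw [← hΦ.graph_companion hgen] at hy
  exact (LinearPMap.mem_graph_iff _).1 hy

lemma domain_malliavinDerivative : (malliavinDerivative Φ).domain = polyFields Φ := by
  rw [malliavinDerivative, Submodule.toLinearPMap_domain, Submodule.map_span, polyFields]
  congr 1
  ext F
  constructor
  · rintro ⟨x, ⟨n, h, p, h1, -⟩, rfl⟩
    exact ⟨n, h, p, h1⟩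
  · rintro ⟨n, h, p, h1⟩
    exact ⟨(F, (hΦ.memLp_gradFun h p 2 (by simp)).toLp),
      ⟨n, h, p, h1, (hΦ.memLp_gradFun h p 2 (by simp)).coeFn_toLp⟩, rfl⟩

lemma domain_companion [CompleteSpace L] (hgen : GeneratesSigmaAlgebra Φ) :
    (companion Φ).domain = tensorFields Φ := by
  rw [companion, Submodule.toLinearPMap_domain, Submodule.map_span, tensorFields,
    ← hΦ.domain_malliavinDerivative]
  congr 1
  ext ψ
  constructor
  · rintro ⟨x, ⟨F, k, h1, -⟩, rfl⟩
    exact ⟨F, F.2, k, h1⟩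
  · rintro ⟨F, hF, k, rfl⟩
    obtain ⟨y, hy⟩ := hΦ.exists_companion_value (hΦ.mem_derivativeGraph hgen ⟨F, hF⟩) k
    exact ⟨(tensor F k, y), ⟨⟨F, hF⟩, k, rfl, hy⟩, rfl⟩

lemma isSymmetricPair [CompleteSpace L] (hgen : GeneratesSigmaAlgebra Φ) :
    IsSymmetricPair (companion Φ) (malliavinDerivative Φ) where
  dense_left := by
    rw [Submodule.dense_iff_topologicalClosure_eq_top, Submodule.topologicalClosure_eq_top_iff,
      Submodule.eq_bot_iff]
    intro U hU
    apply hΦ.eq_zero_of_forall_inner_tensor_eq_zero hgen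
    intro x hx k
    obtain ⟨y, hy⟩ := hΦ.exists_companion_value hx k
    obtain ⟨ψ, h1, -⟩ := hΦ.exists_companion_domain_eq hgen
      (hΦ.tensor_mem_companionGraph hgen hx k hy)
    rw [real_inner_comm]
    have h2 := (Submodule.mem_orthogonal _ _).1 hU _ ψ.2
    rwa [h1] at h2
  dense_right := by
    rw [Submodule.dense_iff_topologicalClosure_eq_top, Submodule.topologicalClosure_eq_top_iff,
      Submodule.eq_bot_iff]
    intro f hf
    apply hΦ.eq_zero_of_forall_inner_eq_zero hgen
    intro x hx
    obtain ⟨F, h1, -⟩ := hΦ.exists_domain_eq hgen hx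
    exact (Submodule.mem_orthogonal _ _).1 hf _ (h1 ▸ F.2)
  formalAdjoint F ψ := by
    have hψ : ((ψ : Lp L 2 P), companion Φ ψ) ∈ companionGraph Φ := by
      rw [← hΦ.graph_companion hgen]
      exact LinearPMap.mem_graph _ ψ
    exact hΦ.inner_eq_inner_of_mem_graph hgen (hΦ.mem_derivativeGraph hgen F) hψ

/-- The operator `1 + S T` has dense range: on powers it acts as
`(Φ h)ⁿ ↦ (n + 1) (Φ h)ⁿ - n (n - 1) ‖h‖² (Φ h)ⁿ⁻²`. -/
lemma eq_zero_of_orthogonal [CompleteSpace L] (hgen : GeneratesSigmaAlgebra Φ)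
    {u : Lp ℝ 2 P} {v : Lp L 2 P} (hS : ∀ y ∈ companionGraph Φ, ⟪v, y.1⟫ = ⟪u, y.2⟫)
    (hT : ∀ x ∈ derivativeGraph Φ, ⟪x.1, u⟫ + ⟪x.2, v⟫ = 0) : u = 0 ∧ v = 0 := by
  have hu : u = 0 := by
    apply hΦ.eq_zero_of_forall_integral_mul_pow_eq_zero hgen
    intro h n
    induction n using Nat.strong_induction_on with
    | _ n ih =>
      have hI : ∀ m, Integrable (fun ω => u ω * Φ h ω ^ m) P := fun m =>
        (Lp.memLp u).integrable_mul (hΦ.memLp_pow h m (q := 2) (by simp))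
      obtain ⟨x, hx, x1, x2⟩ := hΦ.exists_pow_mem_derivativeGraph h n
      obtain ⟨z, hz, z1, z2⟩ := hΦ.exists_pow_mem_derivativeGraph h (n - 1)
      obtain ⟨y, hy⟩ := hΦ.exists_companion_value hz h
      have hx2 : x.2 = (n : ℝ) • tensor z.1 h := by
        apply Lp.ext
        filter_upwards [x2, z1, coeFn_tensor z.1 h,
          Lp.coeFn_smul (n : ℝ) (tensor z.1 h)] with ω w1 w2 w3 w4
        rw [w4, Pi.smul_apply, w3, w1, w2, smul_smul]
      have h1 := hT x hx
      have h2 := hS _ (hΦ.tensor_mem_companionGraph hgen hz h hy)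
      rw [hx2, real_inner_smul_left, real_inner_comm, real_inner_comm v, h2] at h1
      have e1 : ⟪u, x.1⟫ = ∫ ω, u ω * Φ h ω ^ n ∂P := by
        rw [L2.inner_def]
        apply integral_congr_ae
        filter_upwards [x1] with ω w1
        rw [w1]
        simp [mul_comm]
      -- The case n = 0 is separate because n - 1 - 1 would not be smaller than n. For n = 1 the
      -- truncated index is 0, and its coefficient n - 1 vanishes anyway.
      rcases Nat.eq_zero_or_pos n with rfl | hn
      · rw [← e1]
        simpa using h1
      have e2 : ⟪u, y⟫ = ∫ ω, u ω * Φ h ω ^ n ∂P -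
          ((n - 1 : ℕ) * ‖h‖ ^ 2) * ∫ ω, u ω * Φ h ω ^ (n - 1 - 1) ∂P := by
        rw [L2.inner_def, ← integral_const_mul, ← integral_sub (hI n) ((hI _).const_mul _)]
        apply integral_congr_ae
        filter_upwards [hy, z1, z2] with ω w1 w2 w3
        rw [w1, w2, w3, real_inner_smul_left, real_inner_self_eq_norm_sq]
        simp only [RCLike.inner_apply, conj_trivial]
        rw [← mul_pow_sub_one hn.ne' (Φ h ω)]
        ring
      rw [e1, e2, ih (n - 1 - 1) (by omega), mul_zero, sub_zero] at h1
      have h3 : ((n : ℝ) + 1) * ∫ ω, u ω * Φ h ω ^ n ∂P = 0 := by linarith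
      exact (mul_eq_zero.1 h3).resolve_left (by positivity)
  refine ⟨hu, hΦ.eq_zero_of_forall_inner_tensor_eq_zero hgen fun x hx k => ?_⟩
  obtain ⟨y, hy⟩ := hΦ.exists_companion_value hx k
  rw [hS _ (hΦ.tensor_mem_companionGraph hgen hx k hy), hu, inner_zero_left]

lemma isMaximalSymmetricPair [CompleteSpace L] (hgen : GeneratesSigmaAlgebra Φ) :
    IsMaximalSymmetricPair (companion Φ) (malliavinDerivative Φ) := by
  apply (hΦ.isSymmetricPair hgen).isMaximalSymmetricPair
  intro u v hS hT
  rw [hΦ.graph_companion hgen] at hS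
  rw [hΦ.graph_malliavinDerivative hgen] at hT
  exact hΦ.eq_zero_of_orthogonal hgen hS hT

end IsGaussianField

end Operators

end MalliavinCalculus

theorem mainTheorem2 {Ω : Type*} [MeasurableSpace Ω] (P : Measure Ω) [IsProbabilityMeasure P]
    {L : Type*} [NormedAddCommGroup L] [InnerProductSpace ℝ L] [CompleteSpace L]
    (Φ : L →ₗ[ℝ] Lp ℝ 2 P) (hΦ : MalliavinCalculus.IsGaussianField Φ)
    (hgen : MalliavinCalculus.GeneratesSigmaAlgebra Φ) :
    -- `T` is well defined on `𝒟`, and given there by its formula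
    (MalliavinCalculus.malliavinDerivative Φ).domain = MalliavinCalculus.polyFields Φ ∧
    (∀ (n : ℕ) (h : Fin n → L) (p : MvPolynomial (Fin n) ℝ),
      ∃ F : (MalliavinCalculus.malliavinDerivative Φ).domain,
        (F : Lp ℝ 2 P) =ᵐ[P] MalliavinCalculus.polyFun Φ h p ∧
        MalliavinCalculus.malliavinDerivative Φ F =ᵐ[P] MalliavinCalculus.gradFun Φ h p) ∧
    -- `S` is well defined on `𝒟 ⊗ L`, and given there by its formula
    (MalliavinCalculus.companion Φ).domain = MalliavinCalculus.tensorFields Φ ∧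
    (∀ (F : (MalliavinCalculus.malliavinDerivative Φ).domain) (k : L),
      ∃ ψ : (MalliavinCalculus.companion Φ).domain,
        (ψ : Lp L 2 P) = MalliavinCalculus.tensor (F : Lp ℝ 2 P) k ∧
        MalliavinCalculus.companion Φ ψ =ᵐ[P] MalliavinCalculus.companionFun Φ F k) ∧
    -- the closure of `T` is the adjoint of `S`, and `(S, T)` is a maximal symmetric pair
    (MalliavinCalculus.malliavinDerivative Φ).IsClosable ∧
    (MalliavinCalculus.malliavinDerivative Φ).closure = (MalliavinCalculus.companion Φ).adjoint ∧
    MalliavinCalculus.IsMaximalSymmetricPair (MalliavinCalculus.companion Φ)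
      (MalliavinCalculus.malliavinDerivative Φ) := by
  have hmax := hΦ.isMaximalSymmetricPair hgen
  refine ⟨hΦ.domain_malliavinDerivative, fun n h p => ?_, hΦ.domain_companion hgen, fun F k => ?_,
    hmax.closable_right, hmax.closure_right, hmax⟩
  · obtain ⟨x, hx, h1, h2⟩ := hΦ.exists_mem_derivativeGraph h p
    obtain ⟨F, e1, e2⟩ := hΦ.exists_domain_eq hgen hx
    exact ⟨F, e1 ▸ h1, e2 ▸ h2⟩
  · have hF := hΦ.mem_derivativeGraph hgen F
    obtain ⟨y, hy⟩ := hΦ.exists_companion_value hF k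
    obtain ⟨ψ, e1, e2⟩ := hΦ.exists_companion_domain_eq hgen
      (hΦ.tensor_mem_companionGraph hgen hF k hy)
    exact ⟨ψ, e1, e2 ▸ hy⟩
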